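/- Consider algebras $\mathbf A=(A,\wedge,\vee,{}',{}^{\sim},0,1)$ of type $(2,2,1,1,0,0)$. Let $\mathbf D_5$ be the $5$-element antiortholattice chain, i.e. the bounded chain $0<a<b<a'<1$ with the order-reversing involution given by $0'=1$, $b'=b$ and $a\leftrightarrow a'$, and with the trivial Brouwer complement: $0^{\sim}=1$ and $x^{\sim}=0$ for $x\neq 0$. Call $\mathbf A$ a \emph{Kleene--Stone algebra} if (i) $(A,\wedge,\vee,{}',0,1)$ is a Kleene algebra, i.e. a bounded distributive lattice with an order-reversing operation ${}'$ satisfying $x''=x$ and $x\wedge x'\le y\vee y'$; (ii) $(A,\wedge,\vee,{}^{\sim},0,1)$ is a Stone algebra, i.e. it is a quasi-Stone algebra, which means that it is a bounded distributive lattice satisfying $0^{\sim}=1$, $1^{\sim}=0$, $(x\vee y)^{\sim}=x^{\sim}\wedge y^{\sim}$, $(x\wedge y^{\sim})^{\sim}=x^{\sim}\vee y^{\sim\sim}$, $x\le x^{\sim\sim}$ and $x^{\sim}\vee x^{\sim\sim}=1$, and it also satisfies the strong De Morgan law $(x\wedge y)^{\sim}=x^{\sim}\vee y^{\sim}$; (iii)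 the set $\{x^{\sim}:x\in A\}$ is closed under ${}'$. Then the variety $\mathrm{HSP}(\mathbf D_5)$ generated by $\mathbf D_5$ is exactly the class of all Kleene--Stone algebras. -/

import Mathlib

universe u

/-- The operations of an algebra of type `(2,2,1,1,0,0)`: meet `⊓`, join `⊔`, the involution
`inv` (written `x'` on paper), the Brouwer-type complement `br` (written `x^∼` on paper), and the
constants `⊥` (zero) and `⊤` (one). No laws are imposed. -/
class BZOps (A : Type u) extends Min A, Max A, Bot A, Top A where
  inv : A → A
  br : A → A

/-- An algebra of type `(2,2,1,1,0,0)`. -/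
structure BZAlgebra where
  carrier : Type u
  ops : BZOps carrier

namespace BZAlgebra

instance (A : BZAlgebra.{u}) : BZOps A.carrier := A.ops

/-- Homomorphisms of algebras of type `(2,2,1,1,0,0)`. -/
structure IsHom (A B : BZAlgebra.{u}) (f : A.carrier → B.carrier) : Prop where
  map_inf : ∀ x y, f (x ⊓ y) = f x ⊓ f y
  map_sup : ∀ x y, f (x ⊔ y) = f x ⊔ f y
  map_inv : ∀ x, f (BZOps.inv x) = BZOps.inv (f x)
  map_br : ∀ x, f (BZOps.br x) = BZOps.br (f x)
  map_bot : f ⊥ = ⊥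
  map_top : f ⊤ = ⊤

/-- The direct product of a (possibly empty) family of algebras, with pointwise operations. -/
def prod {I : Type u} (F : I → BZAlgebra.{u}) : BZAlgebra.{u} where
  carrier := ∀ i, (F i).carrier
  ops :=
    { min := fun x y i => x i ⊓ y i
      max := fun x y i => x i ⊔ y i
      bot := fun _ => ⊥
      top := fun _ => ⊤
      inv := fun x i => BZOps.inv (x i)
      br := fun x i => BZOps.br (x i) }

/-- `H(K)`: homomorphic images of members of `K`. -/
def homImages (K : Set BZAlgebra.{u}) : Set BZAlgebra.{u} :=
  {A | ∃ B ∈ K, ∃ f : B.carrier → A.carrier, IsHom B A f ∧ Function.Surjective f}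

/-- `S(K)`: algebras isomorphic to a subalgebra of a member of `K`. -/
def subalgebras (K : Set BZAlgebra.{u}) : Set BZAlgebra.{u} :=
  {A | ∃ B ∈ K, ∃ f : A.carrier → B.carrier, IsHom A B f ∧ Function.Injective f}

/-- `P(K)`: algebras isomorphic to a direct product of members of `K`. -/
def products (K : Set BZAlgebra.{u}) : Set BZAlgebra.{u} :=
  {A | ∃ (I : Type u) (F : I → BZAlgebra.{u}), (∀ i, F i ∈ K) ∧
    ∃ f : A.carrier → (prod F).carrier, IsHom A (prod F) f ∧ Function.Bijective f}

/-- The variety `HSP(K)` generated by a class `K` of algebras. -/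
def generatedVariety (K : Set BZAlgebra.{u}) : Set BZAlgebra.{u} :=
  homImages (subalgebras (products K))

/-- The five-element antiortholattice chain `0 < 1 < 2 < 3 < 4`: lattice operations of the chain,
order-reversing involution `x ↦ 4 - x`, and trivial Brouwer complement, sending the bottom to the
top and every other element to the bottom. -/
def D5 : BZAlgebra.{u} where
  carrier := ULift.{u} (Fin 5)
  ops :=
    { min := fun x y => ⟨min x.down y.down⟩
      max := fun x y => ⟨max x.down y.down⟩
      bot := ⟨0⟩
      top := ⟨4⟩
      inv := fun x => ⟨Fin.rev x.down⟩
      br := fun x => ⟨if x.down = 0 then 4 else 0⟩ }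

/-- The order of (the meet-semilattice reduct of) an algebra. -/
def le (A : BZAlgebra.{u}) (x y : A.carrier) : Prop := x ⊓ y = x

/-- The reduct `(A, ⊓, ⊔, ⊥, ⊤)` is a bounded distributive lattice. -/
structure IsBoundedDistribLattice (A : BZAlgebra.{u}) : Prop where
  inf_comm : ∀ x y : A.carrier, x ⊓ y = y ⊓ x
  sup_comm : ∀ x y : A.carrier, x ⊔ y = y ⊔ x
  inf_assoc : ∀ x y z : A.carrier, (x ⊓ y) ⊓ z = x ⊓ (y ⊓ z)
  sup_assoc : ∀ x y z : A.carrier, (x ⊔ y) ⊔ z = x ⊔ (y ⊔ z)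
  inf_sup_self : ∀ x y : A.carrier, x ⊓ (x ⊔ y) = x
  sup_inf_self : ∀ x y : A.carrier, x ⊔ (x ⊓ y) = x
  inf_sup_left : ∀ x y z : A.carrier, x ⊓ (y ⊔ z) = (x ⊓ y) ⊔ (x ⊓ z)
  bot_le : ∀ x : A.carrier, A.le ⊥ x
  le_top : ∀ x : A.carrier, A.le x ⊤

/-- The reduct `(A, ⊓, ⊔, inv, ⊥, ⊤)` is a De Morgan algebra: a bounded distributive lattice with
an order-reversing involution. -/
structure IsDeMorgan (A : BZAlgebra.{u}) : Prop extends IsBoundedDistribLattice A where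
  inv_inv : ∀ x : A.carrier, BZOps.inv (BZOps.inv x) = x
  inv_anti : ∀ x y : A.carrier, A.le x y → A.le (BZOps.inv y) (BZOps.inv x)

/-- The reduct `(A, ⊓, ⊔, inv, ⊥, ⊤)` is a Kleene algebra. -/
structure IsKleene (A : BZAlgebra.{u}) : Prop extends IsDeMorgan A where
  kleene : ∀ x y : A.carrier, A.le (x ⊓ BZOps.inv x) (y ⊔ BZOps.inv y)

/-- The reduct `(A, ⊓, ⊔, br, ⊥, ⊤)` is a quasi-Stone algebra. -/
structure IsQuasiStone (A : BZAlgebra.{u}) : Prop extends IsBoundedDistribLattice A where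
  br_bot : BZOps.br (⊥ : A.carrier) = ⊤
  br_top : BZOps.br (⊤ : A.carrier) = ⊥
  br_sup : ∀ x y : A.carrier, BZOps.br (x ⊔ y) = BZOps.br x ⊓ BZOps.br y
  br_inf_br : ∀ x y : A.carrier,
    BZOps.br (x ⊓ BZOps.br y) = BZOps.br x ⊔ BZOps.br (BZOps.br y)
  le_br_br : ∀ x : A.carrier, A.le x (BZOps.br (BZOps.br x))
  br_sup_br_br : ∀ x : A.carrier, BZOps.br x ⊔ BZOps.br (BZOps.br x) = ⊤

/-- The reduct `(A, ⊓, ⊔, br, ⊥, ⊤)` is a Stone algebra: a quasi-Stone algebra satisfying the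
strong De Morgan identity. -/
structure IsStone (A : BZAlgebra.{u}) : Prop extends IsQuasiStone A where
  strong_deMorgan : ∀ x y : A.carrier, BZOps.br (x ⊓ y) = BZOps.br x ⊔ BZOps.br y

/-- The set of all elements of the form `br a`. -/
def skeleton (A : BZAlgebra.{u}) : Set A.carrier := Set.range BZOps.br

/-- Quasi-Stone De Morgan algebras. -/
structure IsQuasiStoneDeMorgan (A : BZAlgebra.{u}) : Prop where
  deMorgan : IsDeMorgan A
  quasiStone : IsQuasiStone A
  inv_mem_skeleton : ∀ x ∈ A.skeleton, BZOps.inv x ∈ A.skeleton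

/-- Kleene-Stone algebras: quasi-Stone De Morgan algebras whose involution is a Kleene complement
and whose other complement makes the algebra a Stone algebra. -/
structure IsKleeneStone (A : BZAlgebra.{u}) : Prop extends IsQuasiStoneDeMorgan A where
  isKleene : IsKleene A
  isStone : IsStone A

end BZAlgebra

/-! The Kleene–Stone axioms can be expressed by identities in at most three variables. They hold in
`D5` by finite inspection, and identities survive `H`, `S` and `P`. Conversely, a prime filter `p`
yields prime filters `g(p) = {x | x' ∉ p}` and `n(p) = {x | x^∼ ∉ p}`. The crux is `inv_br`, that is
`x^∼' = x^∼∼`: it gives `g(n(p)) ⊆ p` and `g(p) ⊆ n(p)`. If also `p ⊆ g(p)`, counting memberships in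
`g(n(p)) ⊆ p ⊆ g(p) ⊆ n(p)` is a homomorphism to the five-element chain (`isHom_toD5`). The Kleene
law makes `p` and `g(p)` comparable, and `g(g(p)) = p`, so these homomorphisms detect every prime
filter and hence separate points. -/

namespace BZAlgebra

/-! ### Terms and identities -/

/-- Terms in three variables in the language of algebras of type `(2,2,1,1,0,0)`. -/
inductive Term : Type
  | var : Fin 3 → Term
  | inf : Term → Term → Term
  | sup : Term → Term → Term
  | inv : Term → Term
  | br : Term → Term
  | bot : Term
  | top : Term

namespace Term

/-- The value of a term under an assignment of the variables. -/
def eval (A : BZAlgebra.{u}) (v : Fin 3 → A.carrier) : Term → A.carrier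
  | var i => v i
  | inf s t => s.eval A v ⊓ t.eval A v
  | sup s t => s.eval A v ⊔ t.eval A v
  | inv s => BZOps.inv (s.eval A v)
  | br s => BZOps.br (s.eval A v)
  | bot => ⊥
  | top => ⊤

end Term

/-- The identity `s ≈ t` holds in `A`. -/
def Satisfies (A : BZAlgebra.{u}) (s t : Term) : Prop :=
  ∀ v : Fin 3 → A.carrier, s.eval A v = t.eval A v

theorem IsHom.map_eval {A B : BZAlgebra.{u}} {f : A.carrier → B.carrier} (hf : IsHom A B f)
    (v : Fin 3 → A.carrier) (t : Term) : f (t.eval A v) = t.eval B (f ∘ v) := by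
  induction t with
  | var i => rfl
  | inf s t hs ht => simp only [Term.eval, hf.map_inf, hs, ht]
  | sup s t hs ht => simp only [Term.eval, hf.map_sup, hs, ht]
  | inv s hs => simp only [Term.eval, hf.map_inv, hs]
  | br s hs => simp only [Term.eval, hf.map_br, hs]
  | bot => exact hf.map_bot
  | top => exact hf.map_top

theorem isHom_eval_prod {I : Type u} (F : I → BZAlgebra.{u}) (i : I) :
    IsHom (prod F) (F i) (fun x => x i) :=
  ⟨fun _ _ => rfl, fun _ _ => rfl, fun _ => rfl, fun _ => rfl, rfl, rfl⟩

theorem Satisfies.of_injective {A B : BZAlgebra.{u}} {s t : Term} (h : B.Satisfies s t)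
    {f : A.carrier → B.carrier} (hf : IsHom A B f) (hi : Function.Injective f) :
    A.Satisfies s t := fun v => hi (by rw [hf.map_eval, hf.map_eval, h])

theorem Satisfies.of_surjective {A B : BZAlgebra.{u}} {s t : Term} (h : B.Satisfies s t)
    {f : B.carrier → A.carrier} (hf : IsHom B A f) (hs : Function.Surjective f) :
    A.Satisfies s t := fun v => by
  obtain ⟨g, hg⟩ := hs.hasRightInverse
  have hv : f ∘ (g ∘ v) = v := funext fun i => hg (v i)
  rw [← hv, ← hf.map_eval, ← hf.map_eval, h]

theorem Satisfies.prod {I : Type u} {F : I → BZAlgebra.{u}} {s t : Term}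
    (h : ∀ i, (F i).Satisfies s t) : (BZAlgebra.prod F).Satisfies s t := fun v => funext fun i => by
  rw [(isHom_eval_prod F i).map_eval v s, (isHom_eval_prod F i).map_eval v t, h i]

/-- Identities valid throughout a class are valid throughout the variety it generates. -/
theorem Satisfies.of_mem_generatedVariety {K : Set BZAlgebra.{u}} {s t : Term}
    (h : ∀ B ∈ K, B.Satisfies s t) {A : BZAlgebra.{u}} (hA : A ∈ generatedVariety K) :
    A.Satisfies s t := by
  obtain ⟨B, ⟨C, ⟨I, F, hF, e, he, hb⟩, g, hg, hgi⟩, f, hf, hfs⟩ := hA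
  have hP := Satisfies.prod fun i => h (F i) (hF i)
  exact ((hP.of_injective he hb.injective).of_injective hg hgi).of_surjective hf hfs

theorem D5_satisfies {s t : Term}
    (h : ∀ x y z : Fin 5, (s.eval D5.{u} ![⟨x⟩, ⟨y⟩, ⟨z⟩]).down =
      (t.eval D5.{u} ![⟨x⟩, ⟨y⟩, ⟨z⟩]).down) : D5.{u}.Satisfies s t := fun v => by
  have hv : v = ![⟨(v 0).down⟩, ⟨(v 1).down⟩, ⟨(v 2).down⟩] := by
    funext i; fin_cases i <;> rfl
  rw [hv]
  exact ULift.ext _ _ (h _ _ _)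

theorem eval_eq_of_mem_generatedVariety_D5 {A : BZAlgebra.{u}} (hA : A ∈ generatedVariety {D5.{u}})
    (s t : Term)
    (h : ∀ x y z : Fin 5, (s.eval D5.{u} ![⟨x⟩, ⟨y⟩, ⟨z⟩]).down =
      (t.eval D5.{u} ![⟨x⟩, ⟨y⟩, ⟨z⟩]).down) (x y z : A.carrier) :
    s.eval A ![x, y, z] = t.eval A ![x, y, z] :=
  Satisfies.of_mem_generatedVariety (by rintro B rfl; exact D5_satisfies h) hA _

/-! ### The variety generated by `D5` consists of Kleene–Stone algebras. -/

section

open Term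

local notation "X" => var 0
local notation "Y" => var 1
local notation "Z" => var 2

theorem isKleeneStone_of_mem_generatedVariety_D5 {A : BZAlgebra.{u}}
    (hA : A ∈ generatedVariety {D5.{u}}) : IsKleeneStone A := by
  have key := eval_eq_of_mem_generatedVariety_D5 hA
  have hL : IsBoundedDistribLattice A :=
    { inf_comm := fun x y => key (inf X Y) (inf Y X) (by decide) x y x
      sup_comm := fun x y => key (sup X Y) (sup Y X) (by decide) x y x
      inf_assoc := fun x y z => key (inf (inf X Y) Z) (inf X (inf Y Z)) (by decide) x y z
      sup_assoc := fun x y z => key (sup (sup X Y) Z) (sup X (sup Y Z)) (by decide) x y z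
      inf_sup_self := fun x y => key (inf X (sup X Y)) X (by decide) x y x
      sup_inf_self := fun x y => key (sup X (inf X Y)) X (by decide) x y x
      inf_sup_left := fun x y z =>
        key (inf X (sup Y Z)) (sup (inf X Y) (inf X Z)) (by decide) x y z
      bot_le := fun x => key (inf bot X) bot (by decide) x x x
      le_top := fun x => key (inf X top) X (by decide) x x x }
  have hM : IsDeMorgan A :=
    { hL with
      inv_inv := fun x => key (inv (inv X)) X (by decide) x x x
      inv_anti := fun x y h => by
        -- Antitonicity is an implication; this identity is its equational form.
        have h1 : BZOps.inv y ⊓ BZOps.inv (x ⊓ y) = BZOps.inv y :=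
          key (inf (inv Y) (inv (inf X Y))) (inv Y) (by decide) x y x
        rwa [show x ⊓ y = x from h] at h1 }
  have hK : IsKleene A :=
    { hM with
      kleene := fun x y =>
        key (inf (inf X (inv X)) (sup Y (inv Y))) (inf X (inv X)) (by decide) x y x }
  have hQ : IsQuasiStone A :=
    { hL with
      br_bot := key (br bot) top (by decide) ⊥ ⊥ ⊥
      br_top := key (br top) bot (by decide) ⊥ ⊥ ⊥
      br_sup := fun x y => key (br (sup X Y)) (inf (br X) (br Y)) (by decide) x y x
      br_inf_br := fun x y =>
        key (br (inf X (br Y))) (sup (br X) (br (br Y))) (by decide) x y x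
      le_br_br := fun x => key (inf X (br (br X))) X (by decide) x x x
      br_sup_br_br := fun x => key (sup (br X) (br (br X))) top (by decide) x x x }
  exact
    { deMorgan := hM
      quasiStone := hQ
      inv_mem_skeleton := by
        rintro _ ⟨x, rfl⟩
        -- In `D5` the two complements agree on the skeleton, so `x^∼∼` is the witness.
        exact ⟨_, key (br (br X)) (inv (br X)) (by decide) x x x⟩
      isKleene := hK
      isStone :=
        { hQ with
          strong_deMorgan := fun x y =>
            key (br (inf X Y)) (sup (br X) (br Y)) (by decide) x y x } }

end

/-! ### Prime filters -/

/-- The distributive lattice reduct. -/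
abbrev IsBoundedDistribLattice.toDistribLattice {A : BZAlgebra.{u}}
    (h : IsBoundedDistribLattice A) : DistribLattice A.carrier :=
  let : Lattice A.carrier :=
    Lattice.mk' h.sup_comm h.sup_assoc h.inf_comm h.inf_assoc h.sup_inf_self h.inf_sup_self
  DistribLattice.ofInfSupLe fun x y z => (h.inf_sup_left x y z).le

/-- A predicate cutting out a prime filter: a homomorphism of bounded lattices to `Prop`. -/
structure IsPrimeFilter (A : BZAlgebra.{u}) (p : A.carrier → Prop) : Prop where
  inf : ∀ x y, p (x ⊓ y) ↔ p x ∧ p y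
  sup : ∀ x y, p (x ⊔ y) ↔ p x ∨ p y
  bot : ¬ p ⊥
  top : p ⊤

theorem IsPrimeFilter.mono {A : BZAlgebra.{u}} {p : A.carrier → Prop} (hp : IsPrimeFilter A p)
    {x y : A.carrier} (h : A.le x y) (hx : p x) : p y := by
  rw [← show x ⊓ y = x from h, hp.inf] at hx
  exact hx.2

theorem IsBoundedDistribLattice.exists_isPrimeFilter {A : BZAlgebra.{u}}
    (h : IsBoundedDistribLattice A) {a b : A.carrier} (hab : ¬ A.le a b) :
    ∃ p, IsPrimeFilter A p ∧ p a ∧ ¬ p b := by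
  let := h.toDistribLattice
  have hle : ∀ x y : A.carrier, x ≤ y ↔ A.le x y := fun x y => inf_eq_left.symm
  let : BoundedOrder A.carrier :=
    { bot := ⊥, top := ⊤
      bot_le := fun x => (hle _ _).2 (h.bot_le x), le_top := fun x => (hle _ _).2 (h.le_top x) }
  obtain ⟨J, hJ, hbJ, haJ⟩ := DistribLattice.prime_ideal_of_disjoint_filter_ideal
    (F := Order.PFilter.principal a) (I := Order.Ideal.principal b) (by
      rw [Set.disjoint_left]
      exact fun x hx hx' => hab ((hle _ _).1 (le_trans hx hx')))
  refine ⟨fun x => x ∉ J, ⟨fun x y => ?_, fun x y => ?_, ?_, ?_⟩, ?_, ?_⟩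
  · rw [← not_or, not_iff_not]
    exact ⟨hJ.mem_or_mem, fun hxy => hxy.elim (fun hx => J.lower inf_le_left hx)
      fun hy => J.lower inf_le_right hy⟩
  · rw [← not_and_or, not_iff_not]
    exact Order.Ideal.sup_mem_iff
  · exact not_not.2 J.bot_mem
  · exact hJ.toIsProper.top_notMem
  · exact Set.disjoint_left.1 haJ (show a ≤ a from le_rfl)
  · exact not_not.2 (hbJ (show b ≤ b from le_rfl))

/-! ### Separating the points of a Kleene-Stone algebra by homomorphisms to `D5` -/

theorem IsBoundedDistribLattice.le_antisymm {A : BZAlgebra.{u}} (h : IsBoundedDistribLattice A)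
    {x y : A.carrier} (hxy : A.le x y) (hyx : A.le y x) : x = y := by
  rw [← show x ⊓ y = x from hxy, h.inf_comm]
  exact hyx

/-- Elements are equal as soon as they lie in the same prime filters. -/
theorem IsBoundedDistribLattice.ext_isPrimeFilter {A : BZAlgebra.{u}}
    (h : IsBoundedDistribLattice A) {x y : A.carrier}
    (hxy : ∀ p, IsPrimeFilter A p → (p x ↔ p y)) : x = y := by
  apply h.le_antisymm <;> by_contra hn <;> obtain ⟨p, hp, h1, h2⟩ := h.exists_isPrimeFilter hn
  · exact h2 ((hxy p hp).1 h1)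
  · exact h2 ((hxy p hp).2 h1)

/-- The De Morgan laws, read inside `p`, turn meets into joins, and the negation turns them back. -/
theorem IsDeMorgan.isPrimeFilter_inv {A : BZAlgebra.{u}} (h : IsDeMorgan A)
    {p : A.carrier → Prop} (hp : IsPrimeFilter A p) :
    IsPrimeFilter A (fun x => ¬ p (BZOps.inv x)) := by
  have hl : ∀ x y : A.carrier, A.le (x ⊓ y) x := fun x y =>
    show (x ⊓ y) ⊓ x = x ⊓ y by
      rw [h.inf_comm, ← h.inf_assoc]
      congr 1
      -- The two absorption laws together give `x ⊓ x = x`.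
      have := h.inf_sup_self x (x ⊓ x)
      rwa [h.sup_inf_self] at this
  have hr : ∀ x y : A.carrier, A.le x (x ⊔ y) := h.inf_sup_self
  have hl' : ∀ x y : A.carrier, A.le (x ⊓ y) y := fun x y => h.inf_comm x y ▸ hl y x
  have hr' : ∀ x y : A.carrier, A.le y (x ⊔ y) := fun x y => h.sup_comm x y ▸ hr y x
  have anti : ∀ {x y : A.carrier}, A.le x y → p (BZOps.inv y) → p (BZOps.inv x) :=
    fun hxy => hp.mono (h.inv_anti _ _ hxy)
  have hinv : ∀ {x y : A.carrier}, A.le (BZOps.inv x) y → A.le (BZOps.inv y) x := fun {x y} hxy => by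
    have := h.inv_anti _ _ hxy
    rwa [h.inv_inv] at this
  have hinv' : ∀ {x y : A.carrier}, A.le x (BZOps.inv y) → A.le y (BZOps.inv x) :=
    fun {x y} hxy => by
      have := h.inv_anti _ _ hxy
      rwa [h.inv_inv] at this
  refine ⟨fun x y => ?_, fun x y => ?_, ?_, ?_⟩
  · rw [← not_or, not_iff_not, ← hp.sup]
    refine ⟨hp.mono (hinv ?_), fun hxy => ((hp.sup _ _).1 hxy).elim (anti (hl _ _)) (anti (hl' _ _))⟩
    have h1 := hinv (hr (BZOps.inv x) (BZOps.inv y))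
    have h2 := hinv (hr' (BZOps.inv x) (BZOps.inv y))
    unfold le at h1 h2 ⊢
    rw [← h.inf_assoc, h1, h2]
  · rw [← not_and_or, not_iff_not, ← hp.inf]
    refine ⟨fun hxy => (hp.inf _ _).2 ⟨anti (hr _ _) hxy, anti (hr' _ _) hxy⟩, hp.mono (hinv' ?_)⟩
    have h1 := hinv' (hl (BZOps.inv x) (BZOps.inv y))
    have h2 := hinv' (hl' (BZOps.inv x) (BZOps.inv y))
    refine h.toIsBoundedDistribLattice.ext_isPrimeFilter fun q hq => ?_
    rw [hq.inf, hq.sup]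
    exact ⟨And.left, fun h' => ⟨h', h'.elim (hq.mono h1) (hq.mono h2)⟩⟩
  · refine not_not.2 (hp.mono ?_ hp.top)
    have := h.inv_anti _ _ (h.bot_le (BZOps.inv ⊤))
    rwa [h.inv_inv] at this
  · refine fun ht => hp.bot (hp.mono ?_ ht)
    have := h.inv_anti _ _ (h.le_top (BZOps.inv ⊥))
    rwa [h.inv_inv] at this

section

variable {A : BZAlgebra.{u}}

/-- `x^∼` and `x^∼∼` are complements: their join is `⊤`, and applying `∼` to that join gives `x^∼∼ ⊓
x^∼∼∼ = ⊥`, where `x^∼ ≤ x^∼∼∼`. -/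
theorem IsStone.mem_br_br_iff (h : IsStone A) {p : A.carrier → Prop} (hp : IsPrimeFilter A p)
    (x : A.carrier) : p (BZOps.br (BZOps.br x)) ↔ ¬ p (BZOps.br x) := by
  constructor
  · intro h1 h2
    have h4 : BZOps.br (BZOps.br x ⊔ BZOps.br (BZOps.br x)) = ⊥ := by
      rw [h.br_sup_br_br, h.br_top]
    rw [h.br_sup] at h4
    have h5 : p (BZOps.br (BZOps.br (BZOps.br x))) := hp.mono (h.le_br_br (BZOps.br x)) h2
    exact hp.bot (h4 ▸ (hp.inf _ _).2 ⟨h1, h5⟩)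
  · intro h1
    have h2 : p (BZOps.br x ⊔ BZOps.br (BZOps.br x)) := by rw [h.br_sup_br_br]; exact hp.top
    exact ((hp.sup _ _).1 h2).resolve_left h1

/-- The elements whose Brouwer complement avoids a prime filter form a prime filter. -/
theorem IsStone.isPrimeFilter_br (h : IsStone A) {p : A.carrier → Prop} (hp : IsPrimeFilter A p) :
    IsPrimeFilter A (fun x => ¬ p (BZOps.br x)) := by
  refine ⟨fun x y => ?_, fun x y => ?_, ?_, ?_⟩
  · rw [h.strong_deMorgan, hp.sup, not_or]
  · rw [h.br_sup, hp.inf, not_and_or]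
  · rw [h.br_bot]; exact not_not.2 hp.top
  · rw [h.br_top]; exact hp.bot

theorem IsStone.not_mem_br (h : IsStone A) {p : A.carrier → Prop} (hp : IsPrimeFilter A p)
    {x : A.carrier} (hx : p x) : ¬ p (BZOps.br x) :=
  (h.mem_br_br_iff hp x).1 (hp.mono (h.le_br_br x) hx)

/-- In a Kleene-Stone algebra both complements agree on the skeleton. -/
theorem IsKleeneStone.inv_br (h : IsKleeneStone A) (x : A.carrier) :
    BZOps.inv (BZOps.br x) = BZOps.br (BZOps.br x) := by
  have hL := h.deMorgan.toIsBoundedDistribLattice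
  refine hL.ext_isPrimeFilter fun p hp => ?_
  have hg := h.deMorgan.isPrimeFilter_inv hp
  -- Each of `p` and `g(p)` decides between `x^∼` and `x^∼∼`. The Kleene law then forbids `p` to
  -- contain both or neither of `x^∼` and `x^∼'`.
  have h1 := h.isStone.mem_br_br_iff hp x
  have h2 := h.isStone.mem_br_br_iff hg x
  have h3 : p (BZOps.br x) → p (BZOps.inv (BZOps.br x)) →
      p (BZOps.br (BZOps.br x)) ∨ p (BZOps.inv (BZOps.br (BZOps.br x))) := fun ha hb =>
    (hp.sup _ _).1 (hp.mono (h.isKleene.kleene _ _) ((hp.inf _ _).2 ⟨ha, hb⟩))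
  have h4 : p (BZOps.br (BZOps.br x)) → p (BZOps.inv (BZOps.br (BZOps.br x))) →
      p (BZOps.br x) ∨ p (BZOps.inv (BZOps.br x)) := fun ha hb =>
    (hp.sup _ _).1 (hp.mono (h.isKleene.kleene _ _) ((hp.inf _ _).2 ⟨ha, hb⟩))
  tauto

open Classical in
/-- The position in the five-element chain of an element lying in the indicated members of a
four-element chain of prime filters. -/
noncomputable def rank (a b c d : Prop) : Fin 5 :=
  if a then 4 else if b then 3 else if c then 2 else if d then 1 else 0

/-! ### Ranks along a chain of four propositions. -/

section

variable {a b c d a' b' c' d' : Prop}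

theorem rank_cases (h1 : a → b) (h2 : b → c) (h3 : c → d) :
    (a = True ∧ b = True ∧ c = True ∧ d = True) ∨ (a = False ∧ b = True ∧ c = True ∧ d = True) ∨
    (a = False ∧ b = False ∧ c = True ∧ d = True) ∨
    (a = False ∧ b = False ∧ c = False ∧ d = True) ∨
    (a = False ∧ b = False ∧ c = False ∧ d = False) := by
  simp only [eq_iff_iff, iff_true, iff_false]
  tauto

theorem rank_and (h1 : a → b) (h2 : b → c) (h3 : c → d) (h1' : a' → b') (h2' : b' → c')
    (h3' : c' → d') :
    rank (a ∧ a') (b ∧ b') (c ∧ c') (d ∧ d') = min (rank a b c d) (rank a' b' c' d') := by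
  rcases rank_cases h1 h2 h3 with h | h | h | h | h <;>
    rcases rank_cases h1' h2' h3' with h' | h' | h' | h' | h' <;>
    simp only [rank, h, h', and_true, and_false, if_true, if_false] <;> rfl

theorem rank_or (h1 : a → b) (h2 : b → c) (h3 : c → d) (h1' : a' → b') (h2' : b' → c')
    (h3' : c' → d') :
    rank (a ∨ a') (b ∨ b') (c ∨ c') (d ∨ d') = max (rank a b c d) (rank a' b' c' d') := by
  rcases rank_cases h1 h2 h3 with h | h | h | h | h <;>
    rcases rank_cases h1' h2' h3' with h' | h' | h' | h' | h' <;>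
    simp only [rank, h, h', or_true, or_false, if_true, if_false] <;> rfl

theorem rank_not (h1 : a → b) (h2 : b → c) (h3 : c → d) :
    rank (¬ d) (¬ c) (¬ b) (¬ a) = Fin.rev (rank a b c d) := by
  rcases rank_cases h1 h2 h3 with h | h | h | h | h <;>
    simp only [rank, h, not_true, not_false_eq_true, if_true, if_false] <;> rfl

theorem rank_const_not (h1 : a → b) (h2 : b → c) (h3 : c → d) :
    rank (¬ d) (¬ d) (¬ d) (¬ d) = if rank a b c d = 0 then 4 else 0 := by
  rcases rank_cases h1 h2 h3 with h | h | h | h | h <;>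
    simp only [rank, h, not_true, not_false_eq_true, if_true, if_false] <;> rfl

/-- Only the middle two propositions matter later: they stand for `p` and `g(p)`. -/
theorem iff_of_rank_eq (h1 : a → b) (h2 : b → c) (h3 : c → d) (h1' : a' → b') (h2' : b' → c')
    (h3' : c' → d') (h : rank a b c d = rank a' b' c' d') : (b ↔ b') ∧ (c ↔ c') := by
  rcases rank_cases h1 h2 h3 with e | e | e | e | e <;>
    rcases rank_cases h1' h2' h3' with e' | e' | e' | e' | e' <;>
    simp only [rank, e, e', if_true, if_false] at h ⊢ <;>
    first | exact ⟨trivial, trivial⟩ | revert h; decide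

end

/-- The map to `D5` determined by a prime filter `p` contained in its image under the involution. -/
noncomputable def toD5 (p : A.carrier → Prop) (x : A.carrier) : D5.{u}.carrier :=
  ⟨rank (p (BZOps.br (BZOps.inv x))) (p x) (¬ p (BZOps.inv x)) (¬ p (BZOps.br x))⟩

/-- If `x ∈ g(p)` then `x^∼ ∉ g(p)`, so `x^∼' = x^∼∼` lies in `p`. -/
theorem IsKleeneStone.not_mem_br (h : IsKleeneStone A) {p : A.carrier → Prop}
    (hp : IsPrimeFilter A p) {x : A.carrier} (hx : ¬ p (BZOps.inv x)) : ¬ p (BZOps.br x) :=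
  fun hb => by
    have h1 := h.isStone.not_mem_br (h.deMorgan.isPrimeFilter_inv hp) hx
    rw [not_not, h.inv_br, h.isStone.mem_br_br_iff hp] at h1
    exact h1 hb

theorem IsKleeneStone.mem_of_br_inv (h : IsKleeneStone A) {p : A.carrier → Prop}
    (hp : IsPrimeFilter A p) {x : A.carrier} (hx : p (BZOps.br (BZOps.inv x))) : p x := by
  by_contra hn
  rw [← h.deMorgan.inv_inv x] at hn
  exact h.not_mem_br hp hn hx

theorem IsKleeneStone.isHom_toD5 (h : IsKleeneStone A) {p : A.carrier → Prop}
    (hp : IsPrimeFilter A p) (hle : ∀ x, p x → ¬ p (BZOps.inv x)) : IsHom A D5 (toD5 p) := by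
  have hg := h.deMorgan.isPrimeFilter_inv hp
  have hn := h.isStone.isPrimeFilter_br hp
  -- This is `g(n(p))`, the smallest filter of the chain.
  have hm := h.deMorgan.isPrimeFilter_inv hn
  simp only [not_not] at hm
  have hmp : ∀ x, p (BZOps.br (BZOps.inv x)) → p x := fun x => h.mem_of_br_inv hp
  have hgn : ∀ x, ¬ p (BZOps.inv x) → ¬ p (BZOps.br x) := fun x => h.not_mem_br hp
  refine ⟨fun x y => ?_, fun x y => ?_, fun x => ?_, fun x => ?_, ?_, ?_⟩ <;>
    refine ULift.ext _ _ ?_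
  · have key := rank_and (hmp x) (hle x) (hgn x) (hmp y) (hle y) (hgn y)
    rwa [← propext (hm.inf x y), ← propext (hp.inf x y), ← propext (hg.inf x y),
      ← propext (hn.inf x y)] at key
  · have key := rank_or (hmp x) (hle x) (hgn x) (hmp y) (hle y) (hgn y)
    rwa [← propext (hm.sup x y), ← propext (hp.sup x y), ← propext (hg.sup x y),
      ← propext (hn.sup x y)] at key
  · have key := rank_not (hmp x) (hle x) (hgn x)
    rw [not_not, not_not] at key
    change rank _ _ _ _ = _
    rw [h.deMorgan.inv_inv]
    exact key
  · have key := rank_const_not (hmp x) (hle x) (hgn x)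
    rw [not_not] at key
    have e1 := h.isStone.mem_br_br_iff hp x
    have e2 := h.isStone.mem_br_br_iff hp (BZOps.br x)
    change rank _ _ _ _ = _
    -- All four memberships of `x^∼` collapse to `x^∼ ∈ p`, so its rank is 0 or 4.
    rw [h.inv_br, propext e2, propext e1, not_not]
    exact key
  · change rank _ _ _ _ = 0
    simp only [rank, if_neg hm.bot, if_neg hp.bot, if_neg hg.bot, if_neg hn.bot]
  · exact if_pos hm.top

theorem IsKleeneStone.iff_of_toD5_eq (h : IsKleeneStone A) {p : A.carrier → Prop}
    (hp : IsPrimeFilter A p) (hle : ∀ x, p x → ¬ p (BZOps.inv x)) {x y : A.carrier}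
    (hxy : toD5 p x = toD5 p y) : (p x ↔ p y) ∧ (¬ p (BZOps.inv x) ↔ ¬ p (BZOps.inv y)) :=
  iff_of_rank_eq (h.mem_of_br_inv hp) (hle x) (h.not_mem_br hp) (h.mem_of_br_inv hp) (hle y)
    (h.not_mem_br hp) (congrArg ULift.down hxy)

/-- Homomorphisms to `D5` separate the points of a Kleene-Stone algebra. -/
theorem IsKleeneStone.eq_of_forall_isHom (h : IsKleeneStone A) {x y : A.carrier}
    (hxy : ∀ f : A.carrier → D5.{u}.carrier, IsHom A D5 f → f x = f y) : x = y := by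
  refine h.deMorgan.toIsBoundedDistribLattice.ext_isPrimeFilter fun p hp => ?_
  by_cases hle : ∀ z, p z → ¬ p (BZOps.inv z)
  · exact (h.iff_of_toD5_eq hp hle (hxy _ (h.isHom_toD5 hp hle))).1
  · push Not at hle
    obtain ⟨z, hz, hz'⟩ := hle
    have hq := h.deMorgan.isPrimeFilter_inv hp
    -- Since `z ⊓ z' ∈ p`, the Kleene law puts every `w ⊔ w'` in `p`; hence `g(p) ⊆ p = g(g(p))`,
    -- and `g(p)` can replace `p`.
    have hle' : ∀ w, ¬ p (BZOps.inv w) → ¬ ¬ p (BZOps.inv (BZOps.inv w)) := fun w hw => by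
      rw [not_not, h.deMorgan.inv_inv]
      exact ((hp.sup _ _).1
        (hp.mono (h.isKleene.kleene z w) ((hp.inf _ _).2 ⟨hz, hz'⟩))).resolve_right hw
    have key := (h.iff_of_toD5_eq hq hle' (hxy _ (h.isHom_toD5 hq hle'))).2
    simpa only [not_not, h.deMorgan.inv_inv] using key

/-- Evaluation embeds `A` in the power of `D5` indexed by all homomorphisms `A → D5`; the `H` step
is the identity. -/
theorem IsKleeneStone.mem_generatedVariety_D5 (h : IsKleeneStone A) :
    A ∈ generatedVariety {D5.{u}} := by
  let I : Type u := {f : A.carrier → D5.{u}.carrier // IsHom A D5 f}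
  have hid : ∀ B : BZAlgebra.{u}, IsHom B B id := fun B =>
    ⟨fun _ _ => rfl, fun _ _ => rfl, fun _ => rfl, fun _ => rfl, rfl, rfl⟩
  refine ⟨A, ⟨prod fun _ : I => D5, ⟨I, fun _ => D5, fun _ => rfl, id, hid _,
    Function.bijective_id⟩, fun x f => f.1 x, ⟨?_, ?_, ?_, ?_, ?_, ?_⟩, fun x y hxy => ?_⟩, id,
    hid A, Function.surjective_id⟩
  · exact fun x y => funext fun f => f.2.map_inf x y
  · exact fun x y => funext fun f => f.2.map_sup x y
  · exact fun x => funext fun f => f.2.map_inv x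
  · exact fun x => funext fun f => f.2.map_br x
  · exact funext fun f => f.2.map_bot
  · exact funext fun f => f.2.map_top
  · exact h.eq_of_forall_isHom fun f hf => congrFun hxy ⟨f, hf⟩

end

end BZAlgebra

theorem mainTheorem3 :
    BZAlgebra.generatedVariety {BZAlgebra.D5.{u}} =
      {A : BZAlgebra.{u} | BZAlgebra.IsKleeneStone A} :=
  Set.ext fun _ => ⟨BZAlgebra.isKleeneStone_of_mem_generatedVariety_D5,
    BZAlgebra.IsKleeneStone.mem_generatedVariety_D5⟩
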